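/- Let $M$ be a smooth (finite-dimensional, Hausdorff, second countable) manifold without boundary, and let $G$ be a Lie group with Lie algebra $\mathfrak{g}$ acting smoothly and properly on $M$. For $\xi\in\mathfrak{g}$ let $\xi_M$ be the infinitesimal generator of the action, $\xi_M(x)=\frac{d}{dt}\big|_{t=0}\exp(t\xi)\cdot x$. Suppose that there is a $G$-invariant function $h\in C^\infty(M)$ with no critical points, i.e. $\mathrm{d}h(x)\neq 0$ for all $x\in M$. A Poisson structure on $M$ is a smooth bivector field $\pi\in\Gamma(\wedge^2TM)$ with $[\pi,\pi]=0$ for the Schouten–Nijenhuis bracket; $\pi^\sharp:T^*M\to TM$ is given by $\pi^\sharp\alpha=\pi(\alpha,\cdot)$, and the rank of $\pi$ at $x$ is $\dim\pi^\sharp(T_x^*M)$. Then there are a linear subspace $V\subseteq\Gamma(\wedge^2TM)$, all of whose elements are Poisson structures of rank at most two at every point of $M$, and a linear map $\mathfrak{g}\to V$, $\xi\mapsto\pi_\xi$, such that $\pi_\xi^\sharp\,\mathrm{d}h=\xi_M$ for every $\xi\in\mathfrak{g}$. -/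

import Mathlib

open scoped Manifold ContDiff

set_option maxSynthPendingDepth 3

noncomputable section

section Bivector

variable {E : Type*} [NormedAddCommGroup E] [NormedSpace ℝ E]
  {H : Type*} [TopologicalSpace H] (I : ModelWithCorners ℝ E H)
  (M : Type*) [TopologicalSpace M] [ChartedSpace H M]

/-- The cotangent space `T*ₓM`. -/
abbrev CotSpace {M : Type*} [TopologicalSpace M] [ChartedSpace H M] (x : M) : Type _ :=
  TangentSpace I x →L[ℝ] ℝ

/-- Smooth sections of the bundle whose fibre at `x` is the space of bilinear forms on `T*ₓM`,
i.e. (in finite dimension) smooth contravariant 2-tensor fields on `M`. -/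
abbrev ContraTwoTensorField [IsManifold I ∞ M] : Type _ :=
  ContMDiffSection I ((E →L[ℝ] ℝ) →L[ℝ] (E →L[ℝ] ℝ) →L[ℝ] ℝ) ∞
    (fun x : M => CotSpace I x →L[ℝ] CotSpace I x →L[ℝ] ℝ)

/-- Bivector fields `π ∈ Γ(Λ²TM)`: the smooth contravariant 2-tensor fields which are alternating
at every point (in finite dimension an element of `Λ²TₓM` is an alternating bilinear form on
`T*ₓM`, with `(u ∧ v)(α, β) = α(u) β(v) - α(v) β(u)`). They form a real vector space under the
pointwise operations. -/
def BivectorField [IsManifold I ∞ M] : Submodule ℝ (ContraTwoTensorField I M) where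
  carrier := {π | ∀ (x : M) (α : CotSpace I x), π x α α = 0}
  add_mem' {π σ} hπ hσ x α := by
    change π x α α + σ x α α = 0
    rw [hπ x α, hσ x α, add_zero]
  zero_mem' x α := rfl
  smul_mem' c π hπ x α := by
    change c • π x α α = 0
    rw [hπ x α, smul_zero]

end Bivector

namespace BivectorField

variable {E : Type*} [NormedAddCommGroup E] [NormedSpace ℝ E] [FiniteDimensional ℝ E]
  {H : Type*} [TopologicalSpace H] {I : ModelWithCorners ℝ E H}
  {M : Type*} [TopologicalSpace M] [ChartedSpace H M]

/-- The canonical identification `v ↦ (α ↦ α v)` of the finite-dimensional space `TₓM` with its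
double dual. -/
def tangentBidual (x : M) : TangentSpace I x ≃ₗ[ℝ] (CotSpace I x →L[ℝ] ℝ) :=
  haveI : FiniteDimensional ℝ (TangentSpace I x) := inferInstanceAs (FiniteDimensional ℝ E)
  haveI : T2Space (TangentSpace I x) := inferInstanceAs (T2Space E)
  (Module.evalEquiv ℝ (TangentSpace I x)).trans
    ((LinearMap.toContinuousLinearMap (𝕜 := ℝ) (E := TangentSpace I x)
      (F' := ℝ)).symm.dualMap.trans LinearMap.toContinuousLinearMap)

theorem tangentBidual_apply (x : M) (v : TangentSpace I x) (α : CotSpace I x) :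
    tangentBidual x v α = α v := rfl

variable [IsManifold I ∞ M]

/-- The map `π♯ : T*ₓM → TₓM` given by contraction in the first slot, i.e. `π♯ α = π(α, ·)`. -/
def sharp (π : BivectorField I M) (x : M) : CotSpace I x →ₗ[ℝ] TangentSpace I x :=
  (tangentBidual x).symm.toLinearMap ∘ₗ (π.1 x).toLinearMap

theorem apply_sharp (π : BivectorField I M) (x : M) (α β : CotSpace I x) :
    β (sharp π x α) = π.1 x α β := by
  rw [← tangentBidual_apply x (sharp π x α) β, sharp, LinearMap.comp_apply]
  exact congrArg (fun L : CotSpace I x →L[ℝ] ℝ => L β)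
    ((tangentBidual x).apply_symm_apply (π.1 x α))

/-- The rank of `π` at `x`, i.e. the dimension of the image of `π♯ : T*ₓM → TₓM`. -/
def rankAt (π : BivectorField I M) (x : M) : ℕ :=
  Module.finrank ℝ (LinearMap.range (sharp π x))

/-- In the preferred chart around `x₀`, with coordinates `xⁱ`, the 1-form `∑ ℓᵢ dxⁱ` with constant
coefficients `ℓ` (i.e. the differential of the coordinate function `∑ ℓᵢ xⁱ`), evaluated at a
point `p` of the chart. -/
def coordForm (x₀ : M) (ℓ : E →L[ℝ] ℝ) (p : M) : CotSpace I p :=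
  mvfderiv I (fun q : M => ℓ (extChartAt I x₀ q)) p

/-- In the coordinates of the preferred chart at `x`: the number `∑ₗ πⁱˡ ∂ₗσʲᵏ` at `x`
(contracted with `aᵢ bⱼ cₖ`). -/
def schoutenTerm (π σ : BivectorField I M) (x : M) (a b c : E →L[ℝ] ℝ) : ℝ :=
  mvfderiv I (fun p : M => σ.1 p (coordForm x b p) (coordForm x c p)) x
    (sharp π x (coordForm x a x))

/-- The Schouten–Nijenhuis bracket `[π, σ]` of two bivector fields: its components at `x`, in the
coordinates of the preferred chart at `x`, are given by the usual formula
`[π, σ]ⁱʲᵏ = ∑ₗ (πⁱˡ ∂ₗσʲᵏ + σⁱˡ ∂ₗπʲᵏ) + (cyclic permutations of i, j, k)`.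
Here `schoutenBracket π σ x a b c` is the value of the trivector `[π, σ]ₓ` on the covectors
`∑ aᵢ dxⁱ`, `∑ bⱼ dxʲ`, `∑ cₖ dxᵏ` at `x` (all covectors at `x` are of this form). -/
def schoutenBracket (π σ : BivectorField I M) (x : M) (a b c : E →L[ℝ] ℝ) : ℝ :=
  (schoutenTerm π σ x a b c + schoutenTerm π σ x b c a + schoutenTerm π σ x c a b) +
  (schoutenTerm σ π x a b c + schoutenTerm σ π x b c a + schoutenTerm σ π x c a b)

/-- `π` is a Poisson structure: `[π, π] = 0`. -/
def IsPoisson (π : BivectorField I M) : Prop :=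
  ∀ (x : M) (a b c : E →L[ℝ] ℝ), schoutenBracket π π x a b c = 0

end BivectorField

/-- The infinitesimal generator `ξ_M` of a smooth action of a Lie group `G` on `M`:
`ξ_M(x) = d/dt|ₜ₌₀ exp(tξ) • x` is the image of `ξ ∈ 𝔤 = T₁G` under the derivative at `1` of the
orbit map `g ↦ g • x`. -/
def infinitesimalGenerator
    {EG : Type*} [NormedAddCommGroup EG] [NormedSpace ℝ EG]
    {HG : Type*} [TopologicalSpace HG] (IG : ModelWithCorners ℝ EG HG)
    {G : Type*} [TopologicalSpace G] [ChartedSpace HG G] [Group G]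
    {E : Type*} [NormedAddCommGroup E] [NormedSpace ℝ E]
    {H : Type*} [TopologicalSpace H] (I : ModelWithCorners ℝ E H)
    {M : Type*} [TopologicalSpace M] [ChartedSpace H M] [MulAction G M]
    (ξ : GroupLieAlgebra IG G) (x : M) : TangentSpace I x :=
  mfderiv IG I (fun g : G => g • x) 1 ξ

end

section ParametricIntegral

open Set MeasureTheory Function

theorem Continuous.integrable_of_isCompact {G : Type*} [TopologicalSpace G] [MeasurableSpace G]
    [OpensMeasurableSpace G] {μ : Measure G} [IsFiniteMeasureOnCompacts μ]
    {F : Type*} [NormedAddCommGroup F] {K : Set G} (hK : IsCompact K) (hK' : IsClosed K)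
    {φ : G → F} (hφ : Continuous φ) (hφK : ∀ g ∉ K, φ g = 0) : Integrable φ μ :=
  hφ.integrable_of_hasCompactSupport (HasCompactSupport.intro' hK hK' fun g hg => hφK g hg)

variable {E : Type*} [NormedAddCommGroup E] [NormedSpace ℝ E]
  {F : Type*} [NormedAddCommGroup F] [NormedSpace ℝ F]
  {EG : Type*} [NormedAddCommGroup EG] [NormedSpace ℝ EG]
  {HG : Type*} [TopologicalSpace HG] {IG : ModelWithCorners ℝ EG HG}
  {G : Type*} [TopologicalSpace G] [ChartedSpace HG G] [IsManifold IG ∞ G]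

theorem ContMDiffOn.fderiv_fst_apply {U : Set E} (hU : IsOpen U) {f : E → G → F}
    (hf : ContMDiffOn (𝓘(ℝ, E).prod IG) 𝓘(ℝ, F) ∞ (uncurry f) (U ×ˢ univ)) (v : E) :
    ContMDiffOn (𝓘(ℝ, E).prod IG) 𝓘(ℝ, F) ∞
      (uncurry fun y g => fderiv ℝ (fun z => f z g) y v) (U ×ˢ univ) := by
  rintro ⟨y, g⟩ ⟨hy, -⟩
  refine ContMDiffAt.contMDiffWithinAt ?_
  have hfa : ContMDiffAt (𝓘(ℝ, E).prod IG) 𝓘(ℝ, F) ∞ (uncurry f) (y, g) :=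
    hf.contMDiffAt ((hU.prod isOpen_univ).mem_nhds ⟨hy, mem_univ _⟩)
  have h1 : ContMDiffAt ((𝓘(ℝ, E).prod IG).prod 𝓘(ℝ, E)) 𝓘(ℝ, F) ∞
      (uncurry fun (p : E × G) (z : E) => f z p.2) ((y, g), y) := by
    exact ContMDiffAt.comp (f := fun q : (E × G) × E => (q.2, q.1.2)) ((y, g), y) hfa
      (contMDiffAt_snd.prodMk (contMDiffAt_snd.comp _ contMDiffAt_fst))
  have h2 := ContMDiffAt.mfderiv_apply (m := ∞) (N' := E × G) (x₀ := (y, g))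
    (fun (p : E × G) (z : E) => f z p.2)
    Prod.fst id (fun _ => v) h1 contMDiffAt_fst contMDiffAt_id contMDiffAt_const (by simp)
  simpa [inTangentCoordinates_model_space, mfderiv_eq_fderiv, uncurry_def] using h2

variable [FiniteDimensional ℝ E] [MeasurableSpace G] [OpensMeasurableSpace G] {μ : Measure G}
  [IsFiniteMeasureOnCompacts μ]

theorem ContMDiffOn.contDiffOn_integral {U : Set E} (hU : IsOpen U)
    {K : Set G} (hK : IsCompact K) (hK' : IsClosed K) {f : E → G → F}
    (hf : ContMDiffOn (𝓘(ℝ, E).prod IG) 𝓘(ℝ, F) ∞ (uncurry f) (U ×ˢ univ))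
    (hfK : ∀ y ∈ U, ∀ g ∉ K, f y g = 0) :
    ContDiffOn ℝ ∞ (fun y => ∫ g, f y g ∂μ) U := by
  suffices ∀ (n : ℕ), ∀ f : E → G → F,
      ContMDiffOn (𝓘(ℝ, E).prod IG) 𝓘(ℝ, F) ∞ (uncurry f) (U ×ˢ univ) →
      (∀ y ∈ U, ∀ g ∉ K, f y g = 0) → ContDiffOn ℝ n (fun y => ∫ g, f y g ∂μ) U from
    contDiffOn_infty.2 fun n => this n f hf hfK
  clear hf hfK f
  intro n
  induction n with
  | zero =>
    intro f hf hfK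
    exact contDiffOn_zero.2 (continuousOn_integral_of_compact_support hK hf.continuousOn
      fun p x hp hx => hfK p hp x hx)
  | succ n ih =>
    intro f hf hfK
    have hslice : ∀ y ∈ U, Continuous (f y) := fun y hy =>
      continuousOn_univ.1 (hf.continuousOn.comp (f := fun g : G => (y, g)) (by fun_prop) fun g _ => ⟨hy, mem_univ g⟩)
    have hdiff : ∀ y ∈ U, ∀ g, HasFDerivAt (fun z => f z g) (fderiv ℝ (fun z => f z g) y) y := by
      intro y hy g
      have h1 : ContMDiffAt 𝓘(ℝ, E) 𝓘(ℝ, F) ∞ (fun z => f z g) y :=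
        ContMDiffAt.comp (f := fun z : E => (z, g)) y
          (hf.contMDiffAt ((hU.prod isOpen_univ).mem_nhds ⟨hy, mem_univ g⟩))
          (contMDiffAt_id.prodMk contMDiffAt_const)
      exact (h1.contDiffAt.differentiableAt (by simp)).hasFDerivAt
    have hzero : ∀ y ∈ U, ∀ g ∉ K, fderiv ℝ (fun z => f z g) y = 0 := by
      intro y hy g hg
      have : (fun z => f z g) =ᶠ[nhds y] fun _ => 0 := by
        filter_upwards [hU.mem_nhds hy] with z hz using hfK z hz g hg
      rw [this.fderiv_eq]
      simp
    have hcont : ContinuousOn (uncurry fun y g => fderiv ℝ (fun z => f z g) y)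
        (U ×ˢ (univ : Set G)) :=
      continuousOn_clm_apply.2 fun v => (hf.fderiv_fst_apply hU v).continuousOn
    have hcont' : ∀ y ∈ U, Continuous fun g => fderiv ℝ (fun z => f z g) y := fun y hy =>
      continuousOn_univ.1 (hcont.comp (f := fun g : G => (y, g)) (by fun_prop)
        fun g _ => ⟨hy, mem_univ g⟩)
    have hder : ∀ y ∈ U, HasFDerivAt (fun y => ∫ g, f y g ∂μ)
        (∫ g, fderiv ℝ (fun z => f z g) y ∂μ) y := by
      intro y hy
      obtain ⟨ε, hε, hball⟩ := Metric.nhds_basis_closedBall.mem_iff.1 (hU.mem_nhds hy)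
      have hcpt : IsCompact (Metric.closedBall y ε ×ˢ K) :=
        (isCompact_closedBall y ε).prod hK
      obtain ⟨C, hC⟩ := hcpt.exists_bound_of_continuousOn
        (hcont.mono (prod_mono hball (subset_univ _)))
      refine hasFDerivAt_integral_of_dominated_of_fderiv_le (F := fun y g => f y g)
        (F' := fun y g => fderiv ℝ (fun z => f z g) y)
        (bound := K.indicator fun _ => C)
        (Metric.closedBall_mem_nhds y hε) ?_ (Continuous.integrable_of_isCompact hK hK' (hslice y hy) (hfK y hy))
        (Continuous.integrable_of_isCompact hK hK' (hcont' y hy) (hzero y hy)).aestronglyMeasurable ?_ ?_ ?_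
      · filter_upwards [hU.mem_nhds hy] with z hz
        exact (Continuous.integrable_of_isCompact hK hK' (hslice z hz) (hfK z hz)).aestronglyMeasurable
      · refine Filter.Eventually.of_forall fun g z hz => ?_
        by_cases hg : g ∈ K
        · rw [indicator_of_mem hg]
          exact hC (z, g) ⟨hz, hg⟩
        · rw [indicator_of_notMem hg, hzero z (hball hz) g hg, norm_zero]
      · rw [integrable_indicator_iff hK'.measurableSet]
        exact integrableOn_const hK.measure_ne_top
      · exact Filter.Eventually.of_forall fun g z hz => hdiff z (hball hz) g
    have hcast : ((n + 1 : ℕ) : WithTop ℕ∞) = (n : WithTop ℕ∞) + 1 := by norm_cast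
    rw [hcast, contDiffOn_succ_iff_fderiv_apply hU.uniqueDiffOn]
    refine ⟨fun y hy => (hder y hy).differentiableAt.differentiableWithinAt, by simp, ?_⟩
    intro v
    refine (ih (fun y g => fderiv ℝ (fun z => f z g) y v) (hf.fderiv_fst_apply hU v)
      fun y hy g hg => by rw [hzero y hy g hg]; rfl).congr fun y hy => ?_
    rw [fderivWithin_of_isOpen hU hy, (hder y hy).fderiv]
    exact ContinuousLinearMap.integral_apply (Continuous.integrable_of_isCompact hK hK' (hcont' y hy) (hzero y hy)) v

end ParametricIntegral

section Action

open Set MeasureTheory Function Bundle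

variable
    {EG : Type*} [NormedAddCommGroup EG] [NormedSpace ℝ EG]
    {HG : Type*} [TopologicalSpace HG] {IG : ModelWithCorners ℝ EG HG}
    {G : Type*} [TopologicalSpace G] [ChartedSpace HG G] [Group G] [LieGroup IG ∞ G]
    {E : Type*} [NormedAddCommGroup E] [NormedSpace ℝ E]
    {H : Type*} [TopologicalSpace H] {I : ModelWithCorners ℝ E H}
    {M : Type*} [TopologicalSpace M]
    [ChartedSpace H M] [IsManifold I ∞ M]
    [MulAction G M] [ContMDiffSMul IG I ∞ G M]
    {EN : Type*} [NormedAddCommGroup EN] [NormedSpace ℝ EN]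
    {HN : Type*} [TopologicalSpace HN] {IN : ModelWithCorners ℝ EN HN}
    {N : Type*} [TopologicalSpace N] [ChartedSpace HN N]

theorem ContMDiff.tangent_smul {γ : N → TangentBundle IG G} {p : N → TangentBundle I M}
    (hγ : ContMDiff IN IG.tangent ∞ γ) (hp : ContMDiff IN I.tangent ∞ p) :
    ContMDiff IN I.tangent ∞ (fun n =>
      (⟨(γ n).1 • (p n).1, mfderiv IG I (fun g : G => g • (p n).1) (γ n).1 (γ n).2 +
        mfderiv I I (fun x : M => (γ n).1 • x) (p n).1 (p n).2⟩ : TangentBundle I M)) := by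
  have h1 : ContMDiff IN (IG.prod I).tangent ∞ (fun n =>
      (equivTangentBundleProd IG G I M).symm (γ n, p n)) :=
    (contMDiff_equivTangentBundleProd_symm (n := ∞)).comp (hγ.prodMk hp)
  have hs : ContMDiff (IG.prod I) I ∞ (fun q : G × M => q.1 • q.2) := contMDiff_smul
  have h2 := (hs.contMDiff_tangentMap (m := ∞) (by simp)).comp h1
  convert h2 using 2 with n
  simp only [comp_apply, tangentMap]
  congr 1
  rw [mfderiv_prod_eq_add_apply (hs.mdifferentiableAt (by simp))]
  rfl

theorem ContMDiff.mfderiv_const_smul_apply {γ : N → G} {p : N → TangentBundle I M}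
    (hγ : ContMDiff IN IG ∞ γ) (hp : ContMDiff IN I.tangent ∞ p) :
    ContMDiff IN I.tangent ∞ (fun n =>
      (⟨γ n • (p n).1, mfderiv I I (fun x : M => γ n • x) (p n).1 (p n).2⟩ :
        TangentBundle I M)) := by
  have h0 : ContMDiff IN IG.tangent ∞ (fun n => (⟨γ n, 0⟩ : TangentBundle IG G)) :=
    (contMDiff_zeroSection ℝ (TangentSpace IG : G → Type _)).comp hγ
  convert h0.tangent_smul hp using 3 with n
  exact (by simp)

theorem contMDiff_infinitesimalGenerator (ξ : GroupLieAlgebra IG G) :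
    ContMDiff I I.tangent ∞ (fun x : M =>
      (⟨x, infinitesimalGenerator IG I ξ x⟩ : TangentBundle I M)) := by
  have h0 : ContMDiff I IG.tangent ∞ (fun _ : M => (⟨1, ξ⟩ : TangentBundle IG G)) :=
    contMDiff_const
  have h1 : ContMDiff I I.tangent ∞ (fun x : M => (⟨x, 0⟩ : TangentBundle I M)) :=
    contMDiff_zeroSection ℝ (TangentSpace I : M → Type _)
  have key : ∀ (x y : M) (v w : E), x = y → v = w →
      (⟨x, v⟩ : TangentBundle I M) = ⟨y, w⟩ := by
    rintro x _ v _ rfl rfl; rfl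
  refine (h0.tangent_smul h1).congr fun x => ?_
  refine key _ _ _ _ (one_smul G x).symm ?_
  simp only [infinitesimalGenerator]
  erw [map_zero, add_zero]

end Action

section Average

open Set MeasureTheory Function Bundle Topology

variable
    {EG : Type*} [NormedAddCommGroup EG] [NormedSpace ℝ EG]
    {HG : Type*} [TopologicalSpace HG] {IG : ModelWithCorners ℝ EG HG}
    {G : Type*} [TopologicalSpace G] [ChartedSpace HG G] [Group G] [LieGroup IG ∞ G]
    {E : Type*} [NormedAddCommGroup E] [NormedSpace ℝ E] [FiniteDimensional ℝ E]
    {H : Type*} [TopologicalSpace H] {I : ModelWithCorners ℝ E H} [I.Boundaryless]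
    {M : Type*} [TopologicalSpace M]
    [ChartedSpace H M] [IsManifold I ∞ M]
    [MulAction G M] [ContMDiffSMul IG I ∞ G M]

theorem exists_compact_forall_inv_smul_notMem {G M : Type*} [TopologicalSpace G] [Group G]
    [IsTopologicalGroup G] [TopologicalSpace M] [LocallyCompactSpace M] [MulAction G M]
    [ProperSMul G M] {S : Set M} (hS : IsCompact S) (y₀ : M) :
    ∃ C ∈ 𝓝 y₀, ∃ K : Set G, IsCompact K ∧ IsClosed K ∧ ∀ y ∈ C, ∀ g ∉ K, g⁻¹ • y ∉ S := by
  obtain ⟨C, hC, hCy⟩ := exists_compact_mem_nhds y₀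
  have hP := (ProperSMul.isProperMap_smul_pair (G := G) (X := M)).isCompact_preimage (hC.prod hS)
  refine ⟨C, hCy, closure (Prod.fst '' _), (hP.image continuous_fst).closure, isClosed_closure, ?_⟩
  intro y hy g hg hgS
  exact hg (subset_closure ⟨(g, g⁻¹ • y), by simpa using ⟨hy, hgS⟩, rfl⟩)

variable [MeasurableSpace G]

/-- The average over `G` of the push-forwards of the vector field `W` under the action. -/
noncomputable def orbitAverage (μ : Measure G) (W : ∀ x : M, TangentSpace I x) (x : M) :
    TangentSpace I x :=
  (∫ g : G, (mfderiv I I (fun q : M => g • q) (g⁻¹ • x) (W (g⁻¹ • x)) : E) ∂μ : E)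

omit [FiniteDimensional ℝ E] [I.Boundaryless] [MeasurableSpace G] in
theorem contMDiff_pushforward {W : ∀ x : M, TangentSpace I x}
    (hW : ContMDiff I I.tangent ∞ (fun x => (⟨x, W x⟩ : TangentBundle I M))) :
    ContMDiff (I.prod IG) I.tangent ∞ (fun p : M × G =>
      (⟨p.1, (mfderiv I I (fun q : M => p.2 • q) (p.2⁻¹ • p.1) (W (p.2⁻¹ • p.1)) : E)⟩ :
        TangentBundle I M)) := by
  have h1 : ContMDiff (I.prod IG) I ∞ (fun p : M × G => p.2⁻¹ • p.1) :=
    ((contMDiff_inv IG ∞).comp contMDiff_snd).smul contMDiff_fst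
  have key : ∀ (x y : M) (v : E), x = y → (⟨x, v⟩ : TangentBundle I M) = ⟨y, v⟩ := by
    rintro x _ v rfl; rfl
  refine (ContMDiff.mfderiv_const_smul_apply (IG := IG) (γ := fun p : M × G => p.2)
    contMDiff_snd (hW.comp h1)).congr fun p => ?_
  exact key _ _ _ (smul_inv_smul p.2 p.1).symm

variable (IG) [BorelSpace G] {μ : Measure G} [IsFiniteMeasureOnCompacts μ] [ProperSMul G M]

include IG in
theorem contMDiff_orbitAverage {W : ∀ x : M, TangentSpace I x}
    (hW : ContMDiff I I.tangent ∞ (fun x => (⟨x, W x⟩ : TangentBundle I M)))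
    {S : Set M} (hS : IsCompact S) (hWS : ∀ x ∉ S, W x = 0) :
    ContMDiff I I.tangent ∞ (fun x => (⟨x, orbitAverage (I := I) μ W x⟩ : TangentBundle I M)) := by
  have : IsTopologicalGroup G := topologicalGroup_of_lieGroup IG ∞
  have : LocallyCompactSpace M := Manifold.locallyCompact_of_finiteDimensional I
  intro y₀
  obtain ⟨C, hC, K, hK, hK', hCK⟩ := exists_compact_forall_inv_smul_notMem (G := G) hS y₀
  rw [contMDiffAt_totalSpace]
  refine ⟨contMDiffAt_id, ?_⟩
  set e := trivializationAt E (TangentSpace I : M → Type _) y₀ with he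
  let P : M × G → TangentBundle I M := fun p =>
    ⟨p.1, (mfderiv I I (fun q : M => p.2 • q) (p.2⁻¹ • p.1) (W (p.2⁻¹ • p.1)) : E)⟩
  have hP : ContMDiff (I.prod IG) I.tangent ∞ P := contMDiff_pushforward hW
  let f : E → G → E := fun z g => (e (P ((extChartAt I y₀).symm z, g))).2
  obtain ⟨C', hC'C, hC'o, hyC'⟩ := mem_nhds_iff.1 hC
  set U : Set E := (extChartAt I y₀).target ∩ (extChartAt I y₀).symm ⁻¹' C' with hUdef
  have hU : IsOpen U :=
    (continuousOn_extChartAt_symm y₀).isOpen_inter_preimage (isOpen_extChartAt_target y₀) hC'o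
  have hsrc : ∀ z ∈ U, (extChartAt I y₀).symm z ∈ e.baseSet := by
    intro z hz
    have := (extChartAt I y₀).map_target hz.1
    simpa [he, extChartAt_source] using this
  have hf : ContMDiffOn (𝓘(ℝ, E).prod IG) 𝓘(ℝ, E) ∞ (uncurry f) (U ×ˢ univ) := by
    have h1 : ContMDiffOn (𝓘(ℝ, E).prod IG) (I.prod IG) ∞
        (fun p : E × G => ((extChartAt I y₀).symm p.1, p.2)) (U ×ˢ univ) := by
      refine ContMDiffOn.prodMk ?_ contMDiffOn_snd
      exact (contMDiffOn_extChartAt_symm y₀).comp contMDiffOn_fst fun p hp => hp.1.1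
    have h2 := hP.comp_contMDiffOn h1
    intro p hp
    have h3 := h2 p hp
    exact ((e.contMDiffWithinAt_iff (hsrc p.1 hp.1)).1 h3).2
  have hfK : ∀ z ∈ U, ∀ g ∉ K, f z g = 0 := by
    intro z hz g hg
    have h0 : W (g⁻¹ • (extChartAt I y₀).symm z) = 0 := hWS _ (hCK _ (hC'C hz.2) g hg)
    have h1 : P ((extChartAt I y₀).symm z, g) = ⟨(extChartAt I y₀).symm z, 0⟩ := by
      simp only [P, h0]
      congr 1
      exact map_zero _
    simp only [f, h1]
    exact congrArg Prod.snd (e.zeroSection ℝ (hsrc z hz))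
  have hint := hf.contDiffOn_integral (μ := μ) hU hK hK' hfK
  have hy₀ : extChartAt I y₀ y₀ ∈ U := ⟨mem_extChartAt_target y₀, by
    simpa [extChartAt_to_inv] using hyC'⟩
  have h4 : ContMDiffAt I 𝓘(ℝ, E) ∞ (fun y => ∫ g, f (extChartAt I y₀ y) g ∂μ) y₀ :=
    ((hint.contDiffAt (hU.mem_nhds hy₀)).contMDiffAt).comp y₀ contMDiffAt_extChartAt
  refine h4.congr_of_eventuallyEq ?_
  filter_upwards [extChartAt_source_mem_nhds (I := I) y₀] with y hy
  have hyb : y ∈ e.baseSet := by simpa [he, extChartAt_source] using hy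
  let L : E ≃L[ℝ] E := e.continuousLinearEquivAt ℝ y hyb
  let φ : G → E := fun g => mfderiv I I (fun q : M => g • q) (g⁻¹ • y) (W (g⁻¹ • y))
  have hfy : ∀ g, f (extChartAt I y₀ y) g = L (φ g) := by
    intro g
    simp only [f, (extChartAt I y₀).left_inv hy]
    rfl
  simp_rw [hfy]
  exact (ContinuousLinearEquiv.integral_comp_comm L φ).symm

omit [I.Boundaryless] in
include IG in
theorem integrable_pushforward {W : ∀ x : M, TangentSpace I x}
    (hW : ContMDiff I I.tangent ∞ (fun x => (⟨x, W x⟩ : TangentBundle I M)))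
    {S : Set M} (hS : IsCompact S) (hWS : ∀ x ∉ S, W x = 0) (x : M) :
    Integrable (fun g : G =>
      (mfderiv I I (fun q : M => g • q) (g⁻¹ • x) (W (g⁻¹ • x)) : E)) μ := by
  have : IsTopologicalGroup G := topologicalGroup_of_lieGroup IG ∞
  have : LocallyCompactSpace M := Manifold.locallyCompact_of_finiteDimensional I
  obtain ⟨C, hC, K, hK, hK', hCK⟩ := exists_compact_forall_inv_smul_notMem (G := G) hS x
  refine Continuous.integrable_of_isCompact hK hK' ?_ fun g hg => ?_
  · refine (FiberBundle.totalSpaceMk_isInducing E (TangentSpace I : M → Type _) x).continuous_iff.2 ?_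
    exact (contMDiff_pushforward (IG := IG) hW).continuous.comp
      (Continuous.prodMk_right (X := M) (Y := G) x)
  · rw [hWS _ (hCK x (mem_of_mem_nhds hC) g hg)]
    exact map_zero _

omit [FiniteDimensional ℝ E] [I.Boundaryless] [MeasurableSpace G] [BorelSpace G]
  [ProperSMul G M] [IsManifold I ∞ M] [LieGroup IG ∞ G] in
include IG in
theorem mfderiv_mul_smul (k g : G) (x : M) (v : TangentSpace I x) :
    mfderiv I I (fun q : M => k • q) (g • x) (mfderiv I I (fun q : M => g • q) x v) =
      mfderiv I I (fun q : M => (k * g) • q) x v := by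
  have hd : ∀ (g : G) (x : M), MDifferentiableAt I I (fun q : M => g • q) x := fun g x =>
    (ContMDiffSMul.contMDiff_const_smul (I := IG) (n := ∞) g).mdifferentiableAt (by simp)
  have : (fun q : M => (k * g) • q) = (fun q : M => k • q) ∘ fun q : M => g • q := by
    ext q; exact mul_smul k g q
  rw [this, mfderiv_comp x (hd k _) (hd g x)]
  rfl

omit [I.Boundaryless] in
include IG in
theorem mfderiv_const_smul_orbitAverage [μ.IsMulLeftInvariant] {W : ∀ x : M, TangentSpace I x}
    (hW : ContMDiff I I.tangent ∞ (fun x => (⟨x, W x⟩ : TangentBundle I M)))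
    {S : Set M} (hS : IsCompact S) (hWS : ∀ x ∉ S, W x = 0) (k : G) (x : M) :
    mfderiv I I (fun q : M => k • q) x (orbitAverage μ W x) = orbitAverage μ W (k • x) := by
  have : IsTopologicalGroup G := topologicalGroup_of_lieGroup IG ∞
  let L : E →L[ℝ] E := mfderiv I I (fun q : M => k • q) x
  have h1 := ContinuousLinearMap.integral_comp_comm L
    (integrable_pushforward IG (μ := μ) hW hS hWS x)
  refine h1.symm.trans ?_
  let Φ : G → E := fun g =>
    mfderiv I I (fun q : M => g • q) (g⁻¹ • k • x) (W (g⁻¹ • k • x))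
  refine Eq.trans ?_ (integral_mul_left_eq_self (μ := μ) Φ k)
  refine integral_congr_ae (Filter.Eventually.of_forall fun g => ?_)
  have h3 : (k * g)⁻¹ • k • x = g⁻¹ • x := by
    rw [smul_smul]; congr 1; group
  have h4 : ∀ a b : M, a = b → (mfderiv I I (fun q : M => (k * g) • q) a (W a) : E) =
      mfderiv I I (fun q : M => (k * g) • q) b (W b) := by rintro a _ rfl; rfl
  have h5 : ∀ a b : M, a = b → ∀ v : E, (mfderiv I I (fun q : M => k • q) a v : E) =
      mfderiv I I (fun q : M => k • q) b v := by rintro a _ rfl v; rfl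
  exact (h5 _ _ (smul_inv_smul g x).symm _).trans
    ((mfderiv_mul_smul IG k g (g⁻¹ • x) (W (g⁻¹ • x))).trans (h4 _ _ h3.symm))

omit [I.Boundaryless] in
include IG in
theorem mvfderiv_orbitAverage {W : ∀ x : M, TangentSpace I x}
    (hW : ContMDiff I I.tangent ∞ (fun x => (⟨x, W x⟩ : TangentBundle I M)))
    {S : Set M} (hS : IsCompact S) (hWS : ∀ x ∉ S, W x = 0)
    {h : M → ℝ} (hh : MDifferentiable I 𝓘(ℝ, ℝ) h) (hinv : ∀ (g : G) (x : M), h (g • x) = h x)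
    (x : M) :
    mvfderiv I h x (orbitAverage μ W x) =
      ∫ g : G, mvfderiv I h (g⁻¹ • x) (W (g⁻¹ • x)) ∂μ := by
  let L : E →L[ℝ] ℝ := mvfderiv I h x
  refine (ContinuousLinearMap.integral_comp_comm L
    (integrable_pushforward IG (μ := μ) hW hS hWS x)).symm.trans ?_
  refine integral_congr_ae (Filter.Eventually.of_forall fun g => ?_)
  have hd : MDifferentiableAt I I (fun q : M => g • q) (g⁻¹ • x) :=
    (ContMDiffSMul.contMDiff_const_smul (I := IG) (n := ∞) g).mdifferentiableAt (by simp)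
  have h1 : (h ∘ fun q : M => g • q) = h := by ext q; exact hinv g q
  have h2 := mvfderiv_comp_apply_of_eq (g⁻¹ • x) (hh x) hd (smul_inv_smul g x) (W (g⁻¹ • x))
  rw [h1] at h2
  exact h2.symm

end Average

section InvariantFields

open Set MeasureTheory Function Bundle Topology

variable
    {EG : Type*} [NormedAddCommGroup EG] [NormedSpace ℝ EG]
    {HG : Type*} [TopologicalSpace HG] (IG : ModelWithCorners ℝ EG HG)
    {G : Type*} [Group G]
    {E : Type*} [NormedAddCommGroup E] [NormedSpace ℝ E]
    {H : Type*} [TopologicalSpace H] {I : ModelWithCorners ℝ E H}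
    {M : Type*} [TopologicalSpace M] [ChartedSpace H M] [MulAction G M]

/-- A vector field is invariant if it is preserved by the derivative of the action of `G`. -/
def IsInvariantField (G : Type*) [Group G] [MulAction G M] (Y : ∀ x : M, TangentSpace I x) :
    Prop :=
  ∀ (k : G) (x : M), mfderiv I I (fun q : M => k • q) x (Y x) = Y (k • x)

theorem IsInvariantField.smul {Y : ∀ x : M, TangentSpace I x} (hY : IsInvariantField G Y)
    {a : M → ℝ} (ha : ∀ (k : G) (x : M), a (k • x) = a x) : IsInvariantField G (a • Y) := by
  intro k x
  simp only [Pi.smul_apply', map_smul, hY k x, ha]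

theorem IsInvariantField.finsum {ι : Type*} {Y : ι → ∀ x : M, TangentSpace I x}
    (hY : ∀ i, IsInvariantField G (Y i)) (hfin : ∀ x, {i | Y i x ≠ 0}.Finite) :
    IsInvariantField G (fun x => ∑ᶠ i, Y i x) := by
  intro k x
  have h := (mfderiv I I (fun q : M => k • q) x : TangentSpace I x →ₗ[ℝ] TangentSpace I (k • x)
    ).toAddMonoidHom.map_finsum (hfin x)
  exact h.trans (finsum_congr fun i => hY i k x)

variable [TopologicalSpace G] [ChartedSpace HG G]

include IG in
theorem IsInvariantField.mvfderiv_smul [ContMDiffSMul IG I ∞ G M]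
    {Y : ∀ x : M, TangentSpace I x} (hY : IsInvariantField G Y)
    {h : M → ℝ} (hh : MDifferentiable I 𝓘(ℝ, ℝ) h) (hinv : ∀ (g : G) (x : M), h (g • x) = h x)
    (g : G) (x : M) : mvfderiv I h (g • x) (Y (g • x)) = mvfderiv I h x (Y x) := by
  have hd : MDifferentiableAt I I (fun q : M => g • q) x :=
    (ContMDiffSMul.contMDiff_const_smul (I := IG) (n := ∞) g).mdifferentiableAt (by simp)
  have h1 : (h ∘ fun q : M => g • q) = h := by ext q; exact hinv g q
  have h2 := mvfderiv_comp_apply x (hh (g • x)) hd (Y x)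
  rw [h1] at h2
  rw [h2, hY g x]

theorem ContMDiff.mvfderiv_apply [IsManifold I ∞ M] {h : M → ℝ} (hh : ContMDiff I 𝓘(ℝ, ℝ) ∞ h)
    {Y : ∀ x : M, TangentSpace I x}
    (hY : ContMDiff I I.tangent ∞ (fun x => (⟨x, Y x⟩ : TangentBundle I M))) :
    ContMDiff I 𝓘(ℝ, ℝ) ∞ (fun x => mvfderiv I h x (Y x)) :=
  (contMDiff_snd_tangentBundle_modelSpace ℝ 𝓘(ℝ, ℝ)).comp
    ((hh.contMDiff_tangentMap (m := ∞) (by simp)).comp hY)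

variable [FiniteDimensional ℝ E] [I.Boundaryless] [IsManifold I ∞ M]

omit [I.Boundaryless] in
theorem exists_field_mvfderiv_pos [T2Space M] {h : M → ℝ} (hh : ContMDiff I 𝓘(ℝ, ℝ) ∞ h) (x₀ : M)
    (hx₀ : mvfderiv I h x₀ ≠ 0) :
    ∃ W : ∀ x : M, TangentSpace I x,
      ContMDiff I I.tangent ∞ (fun x => (⟨x, W x⟩ : TangentBundle I M)) ∧
      (∃ S : Set M, IsCompact S ∧ ∀ x ∉ S, W x = 0) ∧
      (∀ x, 0 ≤ mvfderiv I h x (W x)) ∧ 0 < mvfderiv I h x₀ (W x₀) := by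
  obtain ⟨v, hv⟩ : ∃ v, mvfderiv I h x₀ v ≠ 0 := by
    by_contra! hcon
    exact hx₀ (ContinuousLinearMap.ext hcon)
  obtain ⟨s, hs, hW₀⟩ := FiberBundle.exists_contMDiffOn_extend I E (k := ∞)
    (V := (TangentSpace I : M → Type _)) v
  obtain ⟨f, -, hf⟩ := (SmoothBumpFunction.nhds_basis_tsupport (I := I) x₀).mem_iff.1
    (interior_mem_nhds.2 hs)
  set W₀ : ∀ x : M, TangentSpace I x := FiberBundle.extend E v
  have hW₁ : ContMDiff I I.tangent ∞
      (fun x => (⟨x, ((f : M → ℝ) • W₀) x⟩ : TangentBundle I M)) :=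
    ContMDiffOn.smul_section_of_tsupport f.contMDiff.contMDiffOn isOpen_interior hf
      (hW₀.mono interior_subset)
  set W₁ := (f : M → ℝ) • W₀ with hW₁def
  have hd := hh.mvfderiv_apply hW₁
  refine ⟨(fun x => mvfderiv I h x (W₁ x)) • W₁, hd.smul_section hW₁,
    ⟨tsupport f, f.hasCompactSupport, fun x hx => ?_⟩, fun x => ?_, ?_⟩
  · simp [hW₁def, image_eq_zero_of_notMem_tsupport hx]
  · simp only [Pi.smul_apply', map_smul, smul_eq_mul]
    exact mul_self_nonneg _
  · simp only [Pi.smul_apply', map_smul, smul_eq_mul]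
    refine mul_self_pos.2 ?_
    simpa [hW₁def, W₀] using hv

variable [FiniteDimensional ℝ EG] [LieGroup IG ∞ G] [ContMDiffSMul IG I ∞ G M]
  [ProperSMul G M]

include IG in
theorem exists_invariantField_mvfderiv_pos [T2Space M] {h : M → ℝ}
    (hh : ContMDiff I 𝓘(ℝ, ℝ) ∞ h) (hinv : ∀ (g : G) (x : M), h (g • x) = h x) (x₀ : M)
    (hx₀ : mvfderiv I h x₀ ≠ 0) :
    ∃ Z : ∀ x : M, TangentSpace I x,
      ContMDiff I I.tangent ∞ (fun x => (⟨x, Z x⟩ : TangentBundle I M)) ∧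
      IsInvariantField G Z ∧
      (∀ x, 0 ≤ mvfderiv I h x (Z x)) ∧ 1 < mvfderiv I h x₀ (Z x₀) := by
  have : IsTopologicalGroup G := topologicalGroup_of_lieGroup IG ∞
  have : LocallyCompactSpace G := Manifold.locallyCompact_of_finiteDimensional IG
  have : LocallyCompactSpace M := Manifold.locallyCompact_of_finiteDimensional I
  let _ : MeasurableSpace G := borel G
  have : BorelSpace G := ⟨rfl⟩
  let μ : Measure G := Measure.haar
  obtain ⟨W, hW, ⟨S, hS, hWS⟩, hpos, hpos₀⟩ := exists_field_mvfderiv_pos hh x₀ hx₀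
  have hhd : MDifferentiable I 𝓘(ℝ, ℝ) h := hh.mdifferentiable (by simp)
  have hZh := mvfderiv_orbitAverage IG (μ := μ) hW hS hWS hhd hinv
  have hZ := contMDiff_orbitAverage IG (μ := μ) hW hS hWS
  have hZinv : IsInvariantField G (orbitAverage (I := I) μ W) :=
    mfderiv_const_smul_orbitAverage IG hW hS hWS
  have hZpos : ∀ x, 0 ≤ mvfderiv I h x (orbitAverage μ W x) := fun x => by
    rw [hZh]; exact integral_nonneg fun g => hpos _
  have hZpos₀ : 0 < mvfderiv I h x₀ (orbitAverage μ W x₀) := by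
    rw [hZh]
    obtain ⟨C, hC, K, hK, hK', hCK⟩ := exists_compact_forall_inv_smul_notMem (G := G) hS x₀
    refine Continuous.integral_pos_of_hasCompactSupport_nonneg_nonzero (x := (1 : G)) ?_ ?_
      (fun g => hpos _) ?_
    · exact (hh.mvfderiv_apply hW).continuous.comp (by fun_prop)
    · refine HasCompactSupport.intro' hK hK' fun g hg => ?_
      rw [hWS _ (hCK x₀ (mem_of_mem_nhds hC) g hg), map_zero]
    · have key : ∀ y, y = x₀ → mvfderiv I h y (W y) ≠ 0 := by rintro _ rfl; exact hpos₀.ne'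
      exact key _ (by simp)
  set c := mvfderiv I h x₀ (orbitAverage μ W x₀)
  refine ⟨(fun _ : M => 2 * c⁻¹) • orbitAverage μ W, contMDiff_const.smul_section hZ,
    hZinv.smul fun _ _ => rfl, fun x => ?_, ?_⟩
  · simp only [Pi.smul_apply', map_smul, smul_eq_mul]
    exact mul_nonneg (by positivity) (hZpos x)
  · simp only [Pi.smul_apply', map_smul, smul_eq_mul]
    change 1 < 2 * c⁻¹ * c
    rw [mul_assoc, inv_mul_cancel₀ hZpos₀.ne']
    norm_num

include IG in
theorem exists_invariantField_mvfderiv_eq_one [T2Space M] [SecondCountableTopology M] {h : M → ℝ}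
    (hh : ContMDiff I 𝓘(ℝ, ℝ) ∞ h) (hinv : ∀ (g : G) (x : M), h (g • x) = h x)
    (hreg : ∀ x, mvfderiv I h x ≠ 0) :
    ∃ Y : ∀ x : M, TangentSpace I x,
      ContMDiff I I.tangent ∞ (fun x => (⟨x, Y x⟩ : TangentBundle I M)) ∧
      IsInvariantField G Y ∧ ∀ x, mvfderiv I h x (Y x) = 1 := by
  have hhd : MDifferentiable I 𝓘(ℝ, ℝ) h := hh.mdifferentiable (by simp)
  cases isEmpty_or_nonempty M with
  | inl hM => exact ⟨fun x => 0, fun x => hM.elim x, fun k x => hM.elim x, fun x => hM.elim x⟩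
  | inr hM =>
  choose Z hZ hZinv hZpos hZ1 using fun x₀ : M =>
    exists_invariantField_mvfderiv_pos IG (G := G) hh hinv x₀ (hreg x₀)
  have hfs := fun x₀ => hh.mvfderiv_apply (hZ x₀)
  obtain ⟨s, hs, hcov⟩ := TopologicalSpace.countable_cover_nhds
    (f := fun x₀ => {x | 1 < mvfderiv I h x (Z x₀ x)})
    fun x₀ => (isOpen_lt continuous_const (hfs x₀).continuous).mem_nhds (hZ1 x₀)
  have hsne : s.Nonempty := by
    by_contra hne
    rw [not_nonempty_iff_eq_empty.1 hne, biUnion_empty] at hcov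
    exact empty_ne_univ hcov
  obtain ⟨u, rfl⟩ := hs.exists_eq_range hsne
  set f : ℕ → M → ℝ := fun j x => mvfderiv I h x (Z (u j) x) with hf
  have hfcov : ∀ x, ∃ j, 1 < f j x := fun x => by
    have := hcov.symm ▸ mem_univ x
    simpa using this
  have hfinv : ∀ j (k : G) x, f j (k • x) = f j x := fun j k x =>
    (hZinv (u j)).mvfderiv_smul IG hhd hinv k x
  let χ : ℕ → M → ℝ := fun j x => Real.smoothTransition (f j x) *
    ∏ k ∈ Finset.range j, (1 - Real.smoothTransition (f k x))
  have hst : ∀ j, ContMDiff I 𝓘(ℝ, ℝ) ∞ fun x => Real.smoothTransition (f j x) := fun j =>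
    Real.smoothTransition.contDiff.contMDiff.comp (hfs (u j))
  have hχ : ∀ j, ContMDiff I 𝓘(ℝ, ℝ) ∞ (χ j) := fun j =>
    (hst j).mul (contMDiff_finsetProd fun k _ => contMDiff_const.sub (hst k))
  have hχinv : ∀ j (k : G) x, χ j (k • x) = χ j x := fun j k x => by
    simp only [χ, hfinv]
  have hχnonneg : ∀ j x, 0 ≤ χ j x := fun j x =>
    mul_nonneg (Real.smoothTransition.nonneg _)
      (Finset.prod_nonneg fun k _ => sub_nonneg.2 (Real.smoothTransition.le_one _))
  have hlf : LocallyFinite fun j => {x : M | (χ j • Z (u j)) x ≠ 0} := by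
    intro x
    obtain ⟨k, hk⟩ := hfcov x
    refine ⟨{y | 1 < f k y},
      (isOpen_lt continuous_const (hfs (u k)).continuous).mem_nhds hk,
      (finite_Iic k).subset ?_⟩
    rintro j ⟨y, hy, hky⟩
    by_contra hj
    refine hy ?_
    have : χ j y = 0 := mul_eq_zero_of_right _ (Finset.prod_eq_zero
      (Finset.mem_range.2 (not_le.1 hj)) (by
        rw [Real.smoothTransition.one_of_one_le (le_of_lt hky), sub_self]))
    simp [this]
  set Y₁ : ∀ x : M, TangentSpace I x := fun x => ∑ᶠ j, (χ j • Z (u j)) x with hY₁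
  have hY₁s : ContMDiff I I.tangent ∞ (fun x => (⟨x, Y₁ x⟩ : TangentBundle I M)) :=
    ContMDiff.finsum_section_of_locallyFinite hlf fun j => (hχ j).smul_section (hZ (u j))
  have hY₁inv : IsInvariantField G Y₁ :=
    IsInvariantField.finsum (fun j => (hZinv (u j)).smul (hχinv j)) hlf.point_finite
  have hY₁h : ∀ x, mvfderiv I h x (Y₁ x) = ∑ᶠ j, χ j x * f j x := fun x => by
    refine ((mvfderiv I h x : TangentSpace I x →ₗ[ℝ] ℝ).toAddMonoidHom.map_finsum
      (hlf.point_finite x)).trans (finsum_congr fun j => ?_)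
    simp [hf]
  have hY₁pos : ∀ x, 0 < mvfderiv I h x (Y₁ x) := fun x => by
    rw [hY₁h]
    classical
    have hex : ∃ j, 1 ≤ f j x := (hfcov x).imp fun j hj => hj.le
    refine finsum_pos (fun j => mul_nonneg (hχnonneg j x) (hZpos (u j) x))
      ⟨Nat.find hex, mul_pos (mul_pos ?_ (Finset.prod_pos fun k hk => sub_pos.2 ?_)) ?_⟩
      ((hlf.point_finite x).subset ?_)
    · exact Real.smoothTransition.pos_of_pos (one_pos.trans_le (Nat.find_spec hex))
    · exact Real.smoothTransition.lt_one_of_lt_one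
        (not_le.1 (Nat.find_min hex (Finset.mem_range.1 hk)))
    · exact one_pos.trans_le (Nat.find_spec hex)
    · intro j hj hj0
      refine hj ?_
      have := congrArg (mvfderiv I h x) hj0
      simpa [hf] using this
  refine ⟨(fun x => (mvfderiv I h x (Y₁ x))⁻¹) • Y₁,
    ((hh.mvfderiv_apply hY₁s).inv₀ fun x => (hY₁pos x).ne').smul_section hY₁s,
    hY₁inv.smul fun k x => by rw [hY₁inv.mvfderiv_smul IG hhd hinv], fun x => ?_⟩
  simp only [Pi.smul_apply', map_smul, smul_eq_mul]
  exact inv_mul_cancel₀ (hY₁pos x).ne'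

end InvariantFields

section Wedge

open Set Function Bundle Topology

/-- The bivector `u ∧ v`, seen as an alternating form on the dual space. -/
noncomputable def wedgeForm {E : Type*} [NormedAddCommGroup E] [NormedSpace ℝ E] (u v : E) :
    (E →L[ℝ] ℝ) →L[ℝ] (E →L[ℝ] ℝ) →L[ℝ] ℝ :=
  (ContinuousLinearMap.apply ℝ ℝ u).smulRight (ContinuousLinearMap.apply ℝ ℝ v) -
    (ContinuousLinearMap.apply ℝ ℝ v).smulRight (ContinuousLinearMap.apply ℝ ℝ u)

theorem contDiff_wedgeForm {E : Type*} [NormedAddCommGroup E] [NormedSpace ℝ E] :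
    ContDiff ℝ ∞ fun p : E × E => wedgeForm p.1 p.2 := by
  unfold wedgeForm
  have h1 : ContDiff ℝ ∞ fun p : E × E => ContinuousLinearMap.apply ℝ ℝ p.1 :=
    (ContinuousLinearMap.contDiff _).comp contDiff_fst
  have h2 : ContDiff ℝ ∞ fun p : E × E => ContinuousLinearMap.apply ℝ ℝ p.2 :=
    (ContinuousLinearMap.contDiff _).comp contDiff_snd
  exact (h1.smulRight h2).sub (h2.smulRight h1)

variable {E : Type*} [NormedAddCommGroup E] [NormedSpace ℝ E]
    {H : Type*} [TopologicalSpace H] {I : ModelWithCorners ℝ E H}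
    {M : Type*} [TopologicalSpace M] [ChartedSpace H M] [IsManifold I ∞ M]

theorem cotSpace_trivializationAt_symm {x₀ x : M}
    (hx : x ∈ (trivializationAt E (TangentSpace I : M → Type _) x₀).baseSet) (α : E →L[ℝ] ℝ)
    (v : TangentSpace I x) :
    ((trivializationAt (E →L[ℝ] ℝ) (fun x : M => CotSpace I x) x₀).symm x α) v =
      α (trivializationAt E (TangentSpace I : M → Type _) x₀ ⟨x, v⟩).2 := by
  set e := trivializationAt E (TangentSpace I : M → Type _) x₀
  set e' := trivializationAt (E →L[ℝ] ℝ) (fun x : M => CotSpace I x) x₀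
  have hx' : x ∈ e'.baseSet := ⟨hx, mem_univ _⟩
  let β : CotSpace I x := α.comp (e.continuousLinearMapAt ℝ x)
  have hβ : (e' ⟨x, β⟩).2 = α := by
    have h := hom_trivializationAt_apply (σ := RingHom.id ℝ) (F₁ := E) (F₂ := ℝ)
      (E₁ := (TangentSpace I : M → Type _)) (E₂ := fun _ : M => ℝ) x₀ ⟨x, β⟩
    refine (congrArg Prod.snd h).trans ?_
    ext w
    refine Eq.trans (b := α (e.continuousLinearMapAt ℝ x (e.symmL ℝ x w))) ?_ ?_
    · simp [ContinuousLinearMap.inCoordinates, β, e]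
    · rw [e.continuousLinearMapAt_symmL hx]
  have h2 := e'.symm_apply_apply_mk hx' β
  rw [hβ] at h2
  rw [h2]
  change α (e.continuousLinearMapAt ℝ x v) = _
  exact congrArg α (congrFun (e.coe_linearMapAt_of_mem (R := ℝ) hx) v)

theorem contMDiff_wedge {Y X : ∀ x : M, TangentSpace I x}
    (hY : ContMDiff I I.tangent ∞ (fun x => (⟨x, Y x⟩ : TangentBundle I M)))
    (hX : ContMDiff I I.tangent ∞ (fun x => (⟨x, X x⟩ : TangentBundle I M))) :
    ContMDiff I (I.prod 𝓘(ℝ, (E →L[ℝ] ℝ) →L[ℝ] (E →L[ℝ] ℝ) →L[ℝ] ℝ)) ∞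
      (fun x => TotalSpace.mk' ((E →L[ℝ] ℝ) →L[ℝ] (E →L[ℝ] ℝ) →L[ℝ] ℝ)
        (E := fun x : M => CotSpace I x →L[ℝ] CotSpace I x →L[ℝ] ℝ) x
        (wedgeForm (E := E) (Y x) (X x))) := by
  intro x₀
  rw [contMDiffAt_hom_bundle]
  refine ⟨contMDiffAt_id, ?_⟩
  have h1 := ((contMDiffAt_totalSpace.1 (hY x₀)).2.prodMk_space
    (contMDiffAt_totalSpace.1 (hX x₀)).2)
  refine ((contDiff_wedgeForm.contDiffAt.contMDiffAt).comp x₀ h1).congr_of_eventuallyEq ?_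
  filter_upwards [(trivializationAt E (TangentSpace I : M → Type _) x₀).open_baseSet.mem_nhds
    (FiberBundle.mem_baseSet_trivializationAt' x₀)] with x hx
  ext α β
  have hx' : x ∈ (trivializationAt (E →L[ℝ] ℝ) (fun x : M => CotSpace I x) x₀).baseSet :=
    ⟨hx, mem_univ _⟩
  have := inCoordinates_apply_eq₂ (𝕜 := ℝ) (F₁ := E →L[ℝ] ℝ) (F₂ := E →L[ℝ] ℝ) (F₃ := ℝ)
    (E₁ := fun x : M => CotSpace I x) (E₂ := fun x : M => CotSpace I x)
    (E₃ := fun _ : M => ℝ) (ϕ := wedgeForm (E := E) (Y x) (X x)) (v := α) (w := β) hx' hx' (mem_univ x)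
  refine this.trans ?_
  have hα := cotSpace_trivializationAt_symm hx α
  have hβ := cotSpace_trivializationAt_symm hx β
  refine Eq.trans (b := wedgeForm (E := E) (Y x) (X x)
    ((trivializationAt (E →L[ℝ] ℝ) (fun x : M => CotSpace I x) x₀).symm x α)
    ((trivializationAt (E →L[ℝ] ℝ) (fun x : M => CotSpace I x) x₀).symm x β)) ?_ ?_
  · simp; rfl
  · exact congrArg₂ (· - ·) (congrArg₂ (· * ·) (hα (Y x)) (hβ (X x)))
      (congrArg₂ (· * ·) (hα (X x)) (hβ (Y x)))

end Wedge

section WedgeField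

open Set Function Bundle Topology

variable {E : Type*} [NormedAddCommGroup E] [NormedSpace ℝ E] [FiniteDimensional ℝ E]
    {H : Type*} [TopologicalSpace H] {I : ModelWithCorners ℝ E H}
    {M : Type*} [TopologicalSpace M] [ChartedSpace H M] [IsManifold I ∞ M]
    {Y X : ∀ x : M, TangentSpace I x}

/-- The bivector field `Y ∧ X`. -/
noncomputable def wedgeField
    (hY : ContMDiff I I.tangent ∞ (fun x => (⟨x, Y x⟩ : TangentBundle I M)))
    (hX : ContMDiff I I.tangent ∞ (fun x => (⟨x, X x⟩ : TangentBundle I M))) :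
    BivectorField I M :=
  ⟨⟨fun x => wedgeForm (E := E) (Y x) (X x), contMDiff_wedge hY hX⟩, fun x α =>
    (congrArg _ (mul_comm _ _)).trans (sub_self (α (Y x) * α (X x)))⟩

variable (hY : ContMDiff I I.tangent ∞ (fun x => (⟨x, Y x⟩ : TangentBundle I M)))
  (hX : ContMDiff I I.tangent ∞ (fun x => (⟨x, X x⟩ : TangentBundle I M)))

omit [FiniteDimensional ℝ E] in
theorem wedgeField_apply (x : M) (α β : CotSpace I x) :
    (wedgeField hY hX).1 x α β = α (Y x) * β (X x) - α (X x) * β (Y x) := rfl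

theorem sharp_wedgeField (x : M) (α : CotSpace I x) :
    BivectorField.sharp (wedgeField hY hX) x α = α (Y x) • X x - α (X x) • Y x := by
  refine (BivectorField.tangentBidual x).injective (ContinuousLinearMap.ext fun β => ?_)
  rw [BivectorField.tangentBidual_apply, BivectorField.tangentBidual_apply,
    BivectorField.apply_sharp, wedgeField_apply, map_sub, map_smul, map_smul]
  rfl

theorem rankAt_wedgeField_le (x : M) : BivectorField.rankAt (wedgeField hY hX) x ≤ 2 := by
  classical
  have : FiniteDimensional ℝ (TangentSpace I x) := inferInstanceAs (FiniteDimensional ℝ E)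
  have hle : LinearMap.range (BivectorField.sharp (wedgeField hY hX) x) ≤
      Submodule.span ℝ (({Y x, X x} : Finset (TangentSpace I x)) : Set (TangentSpace I x)) := by
    rintro _ ⟨α, rfl⟩
    rw [sharp_wedgeField]
    exact Submodule.sub_mem _ (Submodule.smul_mem _ _ (Submodule.subset_span (by simp)))
      (Submodule.smul_mem _ _ (Submodule.subset_span (by simp)))
  exact (Submodule.finrank_mono hle).trans
    ((finrank_span_finset_le_card _).trans Finset.card_le_two)

/-- The vector field `Y` read in the trivialization of the tangent bundle at `x`. -/
noncomputable def coordField (Y : ∀ x : M, TangentSpace I x) (x : M) (p : M) : E :=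
  (trivializationAt E (TangentSpace I : M → Type _) x ⟨p, Y p⟩).2

omit [FiniteDimensional ℝ E] in
include hY in
theorem contMDiffAt_coordField (x : M) : ContMDiffAt I 𝓘(ℝ, E) ∞ (coordField Y x) x :=
  (contMDiffAt_totalSpace.1 (hY x)).2

omit [FiniteDimensional ℝ E] in
theorem coordField_eq_mfderiv (Y : ∀ x : M, TangentSpace I x) {x p : M}
    (hp : p ∈ (chartAt H x).source) :
    coordField Y x p = mfderiv I 𝓘(ℝ, E) (extChartAt I x) p (Y p) := by
  rw [← TangentBundle.continuousLinearMapAt_trivializationAt hp]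
  exact (congrFun ((trivializationAt E (TangentSpace I : M → Type _) x).coe_linearMapAt_of_mem
    (R := ℝ) (by simpa using hp)) (Y p)).symm

omit [FiniteDimensional ℝ E] in
theorem coordForm_apply_eq (ℓ : E →L[ℝ] ℝ) (Y : ∀ x : M, TangentSpace I x) {x p : M}
    (hp : p ∈ (chartAt H x).source) :
    BivectorField.coordForm (I := I) x ℓ p (Y p) = ℓ (coordField Y x p) := by
  have h1 : MDifferentiableAt I 𝓘(ℝ, E) (extChartAt I x) p := mdifferentiableAt_extChartAt hp
  have h2 : MDifferentiableAt 𝓘(ℝ, E) 𝓘(ℝ, ℝ) ℓ (extChartAt I x p) :=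
    ℓ.differentiableAt.mdifferentiableAt
  rw [coordField_eq_mfderiv Y hp]
  have h3 := mfderiv_comp_apply p h2 h1 (Y p)
  rw [mfderiv_eq_fderiv, ℓ.fderiv] at h3
  exact h3

theorem isPoisson_wedgeField
    (hcomm : ∀ (x : M) (ℓ : E →L[ℝ] ℝ),
      mvfderiv I (fun p => ℓ (coordField Y x p)) x (X x) =
        mvfderiv I (fun p => ℓ (coordField X x p)) x (Y x)) :
    BivectorField.IsPoisson (wedgeField hY hX) := by
  intro x a b c
  have hself : x ∈ (chartAt H x).source := mem_chart_source H x
  have hdiff : ∀ {Z : ∀ x : M, TangentSpace I x},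
      ContMDiff I I.tangent ∞ (fun x => (⟨x, Z x⟩ : TangentBundle I M)) → ∀ ℓ : E →L[ℝ] ℝ,
      MDifferentiableAt I 𝓘(ℝ, ℝ) (fun p => ℓ (coordField Z x p)) x := fun hZ ℓ =>
    (ℓ.contMDiff.contMDiffAt.comp x (contMDiffAt_coordField hZ x)).mdifferentiableAt (by simp)
  have hterm : ∀ a b c : E →L[ℝ] ℝ,
      BivectorField.schoutenTerm (wedgeField hY hX) (wedgeField hY hX) x a b c =
      a (coordField Y x x) *
        (b (coordField Y x x) * mvfderiv I (fun p => c (coordField X x p)) x (X x) +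
          c (coordField X x x) * mvfderiv I (fun p => b (coordField Y x p)) x (X x) -
          (b (coordField X x x) * mvfderiv I (fun p => c (coordField Y x p)) x (X x) +
          c (coordField Y x x) * mvfderiv I (fun p => b (coordField X x p)) x (X x))) -
      a (coordField X x x) *
        (b (coordField Y x x) * mvfderiv I (fun p => c (coordField X x p)) x (Y x) +
          c (coordField X x x) * mvfderiv I (fun p => b (coordField Y x p)) x (Y x) -
          (b (coordField X x x) * mvfderiv I (fun p => c (coordField Y x p)) x (Y x) +
          c (coordField Y x x) * mvfderiv I (fun p => b (coordField X x p)) x (Y x))) := by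
    intro a b c
    have heq : (fun p : M => (wedgeField hY hX).1 p (BivectorField.coordForm x b p)
        (BivectorField.coordForm x c p)) =ᶠ[𝓝 x]
        (fun p => b (coordField Y x p)) * (fun p => c (coordField X x p)) -
          (fun p => b (coordField X x p)) * (fun p => c (coordField Y x p)) := by
      filter_upwards [(chartAt H x).open_source.mem_nhds hself] with p hp
      rw [wedgeField_apply, coordForm_apply_eq b Y hp, coordForm_apply_eq c X hp,
        coordForm_apply_eq b X hp, coordForm_apply_eq c Y hp]
      rfl
    have hmv : mvfderiv I (fun p : M => (wedgeField hY hX).1 p (BivectorField.coordForm x b p)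
        (BivectorField.coordForm x c p)) x = mvfderiv I ((fun p => b (coordField Y x p)) *
          (fun p => c (coordField X x p)) -
          (fun p => b (coordField X x p)) * (fun p => c (coordField Y x p))) x := by
      ext v
      exact DFunLike.congr_fun heq.mfderiv_eq v
    rw [BivectorField.schoutenTerm, hmv, sharp_wedgeField,
      mvfderiv_sub ((hdiff hY b).mul (hdiff hX c)) ((hdiff hX b).mul (hdiff hY c)),
      mvfderiv_mul (hdiff hY b) (hdiff hX c), mvfderiv_mul (hdiff hX b) (hdiff hY c),
      coordForm_apply_eq a Y hself, coordForm_apply_eq a X hself]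
    simp
    ring
  simp only [BivectorField.schoutenBracket, hterm]
  simp only [hcomm]
  ring

end WedgeField

section Commutation

open Set Function Bundle Topology

theorem fderiv_fderiv_fst_apply {EG E F : Type*} [NormedAddCommGroup EG] [NormedSpace ℝ EG]
    [NormedAddCommGroup E] [NormedSpace ℝ E] [NormedAddCommGroup F] [NormedSpace ℝ F]
    {f : EG × E → F} {γ₀ : EG} {z₀ : E} (hf : DifferentiableAt ℝ (fderiv ℝ f) (γ₀, z₀))
    (ℓ : F →L[ℝ] ℝ) (w : EG × E) (ξ : EG) :
    fderiv ℝ (fun γ => ℓ (fderiv ℝ f (γ, z₀) w)) γ₀ ξ =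
      ℓ (fderiv ℝ (fderiv ℝ f) (γ₀, z₀) (ξ, 0) w) := by
  have h1 : HasFDerivAt (fun γ : EG => (γ, z₀)) (ContinuousLinearMap.inl ℝ EG E) γ₀ :=
    hasFDerivAt_prodMk_left γ₀ z₀
  have h2 := hf.hasFDerivAt.comp γ₀ h1
  have h3 := (ℓ.comp (ContinuousLinearMap.apply ℝ F w)).hasFDerivAt.comp γ₀ h2
  exact DFunLike.congr_fun h3.fderiv ξ

theorem fderiv_fderiv_snd_apply {EG E F : Type*} [NormedAddCommGroup EG] [NormedSpace ℝ EG]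
    [NormedAddCommGroup E] [NormedSpace ℝ E] [NormedAddCommGroup F] [NormedSpace ℝ F]
    {f : EG × E → F} {γ₀ : EG} {z₀ : E} (hf : DifferentiableAt ℝ (fderiv ℝ f) (γ₀, z₀))
    (ℓ : F →L[ℝ] ℝ) (w : EG × E) (v : E) :
    fderiv ℝ (fun z => ℓ (fderiv ℝ f (γ₀, z) w)) z₀ v =
      ℓ (fderiv ℝ (fderiv ℝ f) (γ₀, z₀) (0, v) w) := by
  have h1 : HasFDerivAt (fun z : E => (γ₀, z)) (ContinuousLinearMap.inr ℝ EG E) z₀ :=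
    hasFDerivAt_prodMk_right γ₀ z₀
  have h2 := hf.hasFDerivAt.comp z₀ h1
  have h3 := (ℓ.comp (ContinuousLinearMap.apply ℝ F w)).hasFDerivAt.comp z₀ h2
  exact DFunLike.congr_fun h3.fderiv v

theorem mfderiv_extChartAt_symm_self {E : Type*} [NormedAddCommGroup E] [NormedSpace ℝ E]
    {H : Type*} [TopologicalSpace H] {I : ModelWithCorners ℝ E H} [I.Boundaryless]
    {M : Type*} [TopologicalSpace M] [ChartedSpace H M] [IsManifold I 1 M] (x : M) (v : E) :
    mfderiv 𝓘(ℝ, E) I (extChartAt I x).symm (extChartAt I x x) v = v := by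
  have h := mfderivWithin_range_extChartAt_symm (I := I) (x := x)
  rw [I.range_eq_univ, mfderivWithin_univ] at h
  exact DFunLike.congr_fun h v

variable
    {EG : Type*} [NormedAddCommGroup EG] [NormedSpace ℝ EG]
    {HG : Type*} [TopologicalSpace HG] {IG : ModelWithCorners ℝ EG HG} [IG.Boundaryless]
    {G : Type*} [TopologicalSpace G] [ChartedSpace HG G] [Group G] [LieGroup IG ∞ G]
    {E : Type*} [NormedAddCommGroup E] [NormedSpace ℝ E]
    {H : Type*} [TopologicalSpace H] {I : ModelWithCorners ℝ E H} [I.Boundaryless]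
    {M : Type*} [TopologicalSpace M] [ChartedSpace H M] [IsManifold I ∞ M]
    [MulAction G M] [ContMDiffSMul IG I ∞ G M]

theorem IsInvariantField.mvfderiv_coordField_comm {Y : ∀ x : M, TangentSpace I x}
    (hY : ContMDiff I I.tangent ∞ (fun x => (⟨x, Y x⟩ : TangentBundle I M)))
    (hinv : IsInvariantField G Y) (ξ : GroupLieAlgebra IG G) (x : M) (ℓ : E →L[ℝ] ℝ) :
    mvfderiv I (fun p => ℓ (coordField Y x p)) x (infinitesimalGenerator IG I ξ x) =
      mvfderiv I (fun p => ℓ (coordField (infinitesimalGenerator IG I ξ) x p)) x (Y x) := by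
  let v : E := Y x
  let ξ' : EG := ξ
  set φ := extChartAt I x with hφ
  set ψ := extChartAt IG (1 : G) with hψ
  set z₀ : E := φ x with hz₀
  set γ₀ : EG := ψ 1 with hγ₀
  have hφz₀ : φ.symm z₀ = x := extChartAt_to_inv x
  have hψγ₀ : ψ.symm γ₀ = 1 := extChartAt_to_inv 1
  let F : EG × E → E := fun q => φ (ψ.symm q.1 • φ.symm q.2)
  have hφs : ContMDiffAt 𝓘(ℝ, E) I ∞ φ.symm z₀ :=
    (contMDiffOn_extChartAt_symm x).contMDiffAt (extChartAt_target_mem_nhds x)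
  have hψs : ContMDiffAt 𝓘(ℝ, EG) IG ∞ ψ.symm γ₀ :=
    (contMDiffOn_extChartAt_symm (1 : G)).contMDiffAt (extChartAt_target_mem_nhds (1 : G))
  have hsm : ContMDiff (IG.prod I) I ∞ (fun q : G × M => q.1 • q.2) := contMDiff_smul
  have hsg : ∀ p : M, ContMDiff IG I ∞ (fun g : G => g • p) := fun p =>
    hsm.comp (contMDiff_id.prodMk contMDiff_const)
  have hsp : ∀ g : G, ContMDiff I I ∞ (fun p : M => g • p) := fun g =>
    ContMDiffSMul.contMDiff_const_smul (I := IG) g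
  have hF : ContDiffAt ℝ ∞ F (γ₀, z₀) := by
    rw [← contMDiffAt_iff_contDiffAt]
    have h1 : ContMDiffAt 𝓘(ℝ, EG × E) I ∞ (fun q : EG × E => ψ.symm q.1 • φ.symm q.2)
        (γ₀, z₀) := by
      rw [modelWithCornersSelf_prod, ← chartedSpaceSelf_prod]
      exact (hψs.comp (γ₀, z₀) contMDiffAt_fst).smul (hφs.comp (γ₀, z₀) contMDiffAt_snd)
    refine ContMDiffAt.comp_of_eq (y := x) ?_ h1 ?_
    · exact contMDiffAt_extChartAt
    · simp only [hφz₀, hψγ₀, one_smul]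
  have hFd : ∀ᶠ q in 𝓝 (γ₀, z₀), DifferentiableAt ℝ F q :=
    ((hF.of_le (m := 1) (by norm_cast)).eventually (by simp)).mono fun q hq =>
      hq.differentiableAt (by simp)
  have hF2 : DifferentiableAt ℝ (fderiv ℝ F) (γ₀, z₀) :=
    (hF.fderiv_right (m := 1) (by norm_cast)).differentiableAt (by simp)
  have hsymm : IsSymmSndFDerivAt ℝ F (γ₀, z₀) := hF.isSymmSndFDerivAt (by
    rw [minSmoothness_of_isRCLikeNormedField]; norm_cast)
  have hmf : ∀ p ∈ (chartAt H x).source, MDifferentiableAt I 𝓘(ℝ, E) φ p :=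
    fun p hp => mdifferentiableAt_extChartAt hp
  have horb : ∀ p : M, mfderiv 𝓘(ℝ, EG) I ((fun g : G => g • p) ∘ ψ.symm) γ₀ ξ' =
      infinitesimalGenerator IG I ξ p := fun p =>
    (mfderiv_comp_apply_of_eq γ₀ ((hsg p).mdifferentiableAt (by simp))
      (hψs.mdifferentiableAt (by simp)) hψγ₀ ξ').trans
      (congrArg _ (mfderiv_extChartAt_symm_self (I := IG) (1 : G) ξ'))
  have hgen : ∀ᶠ z in 𝓝 z₀, coordField (infinitesimalGenerator IG I ξ) x (φ.symm z) =
      fderiv ℝ F (γ₀, z) (ξ', 0) := by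
    have h1 : ∀ᶠ z in 𝓝 z₀, DifferentiableAt ℝ F (γ₀, z) :=
      (Continuous.prodMk_right γ₀).continuousAt.eventually hFd
    filter_upwards [h1, extChartAt_target_mem_nhds (I := I) x] with z hz hzt
    have hp : φ.symm z ∈ (chartAt H x).source := by
      rw [← extChartAt_source I x]
      exact φ.map_target hzt
    rw [coordField_eq_mfderiv _ hp]
    have h2 : fderiv ℝ (fun γ => F (γ, z)) γ₀ ξ' = fderiv ℝ F (γ₀, z) (ξ', 0) :=
      DFunLike.congr_fun (HasFDerivAt.comp (g := F) γ₀ hz.hasFDerivAt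
        (hasFDerivAt_prodMk_left (𝕜 := ℝ) γ₀ z)).fderiv ξ'
    have h4 := mfderiv_comp_apply_of_eq γ₀ (hmf _ hp)
      (((hsg (φ.symm z)).contMDiffAt.comp γ₀ hψs).mdifferentiableAt (by simp))
      (by simp [hψγ₀]) ξ'
    rw [mfderiv_eq_fderiv] at h4
    exact (h2.symm.trans (h4.trans (congrArg _ (horb _)))).symm
  have hpush : ∀ᶠ γ in 𝓝 γ₀, coordField Y x (ψ.symm γ • x) = fderiv ℝ F (γ, z₀) (0, v) := by
    have h1 : ∀ᶠ γ in 𝓝 γ₀, DifferentiableAt ℝ F (γ, z₀) :=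
      (Continuous.prodMk_left z₀).continuousAt.eventually hFd
    have hp0 : ∀ᶠ γ in 𝓝 γ₀, ψ.symm γ • x ∈ (chartAt H x).source := by
      refine ((hsg x).continuous.continuousAt.comp hψs.continuousAt).eventually ?_
      refine (chartAt H x).open_source.mem_nhds ?_
      simp [hψγ₀]
    filter_upwards [h1, hp0] with γ hγ hp
    rw [coordField_eq_mfderiv _ hp, ← hinv (ψ.symm γ) x]
    have h2 : fderiv ℝ (fun z => F (γ, z)) z₀ v = fderiv ℝ F (γ, z₀) (0, v) :=
      DFunLike.congr_fun (HasFDerivAt.comp (g := F) z₀ hγ.hasFDerivAt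
        (hasFDerivAt_prodMk_right (𝕜 := ℝ) γ z₀)).fderiv v
    have h3 : mfderiv 𝓘(ℝ, E) I ((fun p : M => ψ.symm γ • p) ∘ φ.symm) z₀ v =
        mfderiv I I (fun p : M => ψ.symm γ • p) x (Y x) :=
      (mfderiv_comp_apply_of_eq z₀ ((hsp _).mdifferentiableAt (by simp))
        (hφs.mdifferentiableAt (by simp)) hφz₀ v).trans
        (congrArg _ (mfderiv_extChartAt_symm_self (I := I) x v))
    have h4 := mfderiv_comp_apply_of_eq z₀ (hmf _ hp)
      (((hsp (ψ.symm γ)).contMDiffAt.comp z₀ hφs).mdifferentiableAt (by simp))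
      (by simp [hφz₀]) v
    rw [mfderiv_eq_fderiv] at h4
    exact (h2.symm.trans (h4.trans (congrArg _ h3))).symm
  have hdiff : ∀ {Z : ∀ x : M, TangentSpace I x},
      ContMDiff I I.tangent ∞ (fun x => (⟨x, Z x⟩ : TangentBundle I M)) →
      MDifferentiableAt I 𝓘(ℝ, ℝ) (fun p => ℓ (coordField Z x p)) x := fun hZ =>
    (ℓ.contMDiff.contMDiffAt.comp x (contMDiffAt_coordField hZ x)).mdifferentiableAt (by simp)
  have hL : mvfderiv I (fun p => ℓ (coordField Y x p)) x (infinitesimalGenerator IG I ξ x) =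
      ℓ (fderiv ℝ (fderiv ℝ F) (γ₀, z₀) (ξ', 0) (0, v)) := by
    have h1 : fderiv ℝ ((fun p => ℓ (coordField Y x p)) ∘ ((fun g : G => g • x) ∘ ψ.symm)) γ₀ ξ' =
        fderiv ℝ (fun γ => ℓ (fderiv ℝ F (γ, z₀) (0, v))) γ₀ ξ' :=
      DFunLike.congr_fun (Filter.EventuallyEq.fderiv_eq (hpush.mono fun γ hγ => congrArg ℓ hγ)) ξ'
    have h4 := mvfderiv_comp_apply_of_eq γ₀ (hdiff hY)
      (((hsg x).contMDiffAt.comp γ₀ hψs).mdifferentiableAt (by simp)) (by simp [hψγ₀]) ξ'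
    rw [← fderiv_fderiv_fst_apply hF2, ← h1, ← mfderiv_eq_fderiv]
    exact (h4.trans (congrArg _ (horb _))).symm
  have hR : mvfderiv I (fun p => ℓ (coordField (infinitesimalGenerator IG I ξ) x p)) x (Y x) =
      ℓ (fderiv ℝ (fderiv ℝ F) (γ₀, z₀) (0, v) (ξ', 0)) := by
    have h1 : fderiv ℝ ((fun p => ℓ (coordField (infinitesimalGenerator IG I ξ) x p)) ∘ φ.symm)
        z₀ v = fderiv ℝ (fun z => ℓ (fderiv ℝ F (γ₀, z) (ξ', 0))) z₀ v :=
      DFunLike.congr_fun (Filter.EventuallyEq.fderiv_eq (hgen.mono fun z hz => congrArg ℓ hz)) v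
    have h4 := mvfderiv_comp_apply_of_eq z₀ (hdiff (contMDiff_infinitesimalGenerator ξ))
      (hφs.mdifferentiableAt (by simp)) hφz₀ v
    rw [← fderiv_fderiv_snd_apply hF2, ← h1, ← mfderiv_eq_fderiv]
    exact (h4.trans (congrArg _ (mfderiv_extChartAt_symm_self (I := I) x v))).symm
  rw [hL, hR]
  exact congrArg ℓ (hsymm.eq _ _)

end Commutation

theorem mvfderiv_infinitesimalGenerator_eq_zero
    {EG : Type*} [NormedAddCommGroup EG] [NormedSpace ℝ EG]
    {HG : Type*} [TopologicalSpace HG] {IG : ModelWithCorners ℝ EG HG}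
    {G : Type*} [TopologicalSpace G] [ChartedSpace HG G] [Group G]
    {E : Type*} [NormedAddCommGroup E] [NormedSpace ℝ E]
    {H : Type*} [TopologicalSpace H] {I : ModelWithCorners ℝ E H}
    {M : Type*} [TopologicalSpace M] [ChartedSpace H M]
    [MulAction G M] [ContMDiffSMul IG I ∞ G M]
    {h : M → ℝ} (hh : MDifferentiable I 𝓘(ℝ, ℝ) h) (hinv : ∀ (g : G) (x : M), h (g • x) = h x)
    (ξ : GroupLieAlgebra IG G) (x : M) :
    mvfderiv I h x (infinitesimalGenerator IG I ξ x) = 0 := by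
  have hs : ContMDiff (IG.prod I) I ∞ (fun q : G × M => q.1 • q.2) := contMDiff_smul
  have hd : MDifferentiableAt IG I (fun g : G => g • x) 1 :=
    (hs.comp (contMDiff_id.prodMk contMDiff_const)).mdifferentiableAt (by simp)
  have h1 := mvfderiv_comp_apply_of_eq (1 : G) (hh x) hd (one_smul G x) ξ
  have h2 : (h ∘ fun g : G => g • x) = fun _ => h x := funext fun g => hinv g x
  rw [h2, mvfderiv_const] at h1
  exact h1.symm

theorem proposition5p6
    {EG : Type*} [NormedAddCommGroup EG] [NormedSpace ℝ EG] [FiniteDimensional ℝ EG]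
    {HG : Type*} [TopologicalSpace HG] (IG : ModelWithCorners ℝ EG HG) [IG.Boundaryless]
    {G : Type*} [TopologicalSpace G] [ChartedSpace HG G] [Group G] [LieGroup IG ∞ G]
    {E : Type*} [NormedAddCommGroup E] [NormedSpace ℝ E] [FiniteDimensional ℝ E]
    {H : Type*} [TopologicalSpace H] (I : ModelWithCorners ℝ E H) [I.Boundaryless]
    {M : Type*} [TopologicalSpace M] [T2Space M] [SecondCountableTopology M]
    [ChartedSpace H M] [IsManifold I ∞ M]
    [MulAction G M] [ContMDiffSMul IG I ∞ G M] [ProperSMul G M]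
    (h : M → ℝ) (hsmooth : ContMDiff I 𝓘(ℝ, ℝ) ∞ h)
    (hinv : ∀ (g : G) (x : M), h (g • x) = h x)
    (hreg : ∀ x : M, mvfderiv I h x ≠ 0) :
    ∃ V : Submodule ℝ (BivectorField I M),
      (∀ π ∈ V, BivectorField.IsPoisson π ∧ ∀ x : M, BivectorField.rankAt π x ≤ 2) ∧
      ∃ Φ : GroupLieAlgebra IG G →ₗ[ℝ] V,
        ∀ (ξ : GroupLieAlgebra IG G) (x : M),
          BivectorField.sharp (Φ ξ : BivectorField I M) x (mvfderiv I h x) =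
            infinitesimalGenerator IG I ξ x := by
  obtain ⟨Y, hY, hYinv, hY1⟩ := exists_invariantField_mvfderiv_eq_one IG (G := G) hsmooth hinv hreg
  let L : GroupLieAlgebra IG G →ₗ[ℝ] BivectorField I M :=
    { toFun := fun ξ => wedgeField hY (contMDiff_infinitesimalGenerator ξ)
      map_add' := fun ξ η => by
        refine Subtype.ext (ContMDiffSection.ext fun x => ?_)
        refine ContinuousLinearMap.ext fun α => ContinuousLinearMap.ext fun β => ?_
        change α (Y x) * β (infinitesimalGenerator IG I (ξ + η) x) -
            α (infinitesimalGenerator IG I (ξ + η) x) * β (Y x) =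
          (α (Y x) * β (infinitesimalGenerator IG I ξ x) -
            α (infinitesimalGenerator IG I ξ x) * β (Y x)) +
          (α (Y x) * β (infinitesimalGenerator IG I η x) -
            α (infinitesimalGenerator IG I η x) * β (Y x))
        have hadd : infinitesimalGenerator IG I (ξ + η) x =
            infinitesimalGenerator IG I ξ x + infinitesimalGenerator IG I η x := map_add _ _ _
        rw [hadd, map_add, map_add]
        ring
      map_smul' := fun c ξ => by
        refine Subtype.ext (ContMDiffSection.ext fun x => ?_)
        refine ContinuousLinearMap.ext fun α => ContinuousLinearMap.ext fun β => ?_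
        change α (Y x) * β (infinitesimalGenerator IG I (c • ξ) x) -
            α (infinitesimalGenerator IG I (c • ξ) x) * β (Y x) =
          c * (α (Y x) * β (infinitesimalGenerator IG I ξ x) -
            α (infinitesimalGenerator IG I ξ x) * β (Y x))
        have hsmul : infinitesimalGenerator IG I (c • ξ) x =
            c • infinitesimalGenerator IG I ξ x := map_smul _ _ _
        rw [hsmul, map_smul, map_smul, smul_eq_mul, smul_eq_mul]
        ring }
  refine ⟨LinearMap.range L, ?_, L.rangeRestrict, fun ξ x => ?_⟩
  · rintro _ ⟨ξ, rfl⟩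
    exact ⟨isPoisson_wedgeField hY (contMDiff_infinitesimalGenerator ξ)
      (hYinv.mvfderiv_coordField_comm hY ξ), rankAt_wedgeField_le hY (contMDiff_infinitesimalGenerator ξ)⟩
  · refine (sharp_wedgeField hY (contMDiff_infinitesimalGenerator ξ) x (mvfderiv I h x)).trans ?_
    rw [hY1, mvfderiv_infinitesimalGenerator_eq_zero (hsmooth.mdifferentiable (by simp)) hinv,
      one_smul, zero_smul, sub_zero]
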